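/- Let $\alpha>0$ and $\beta\neq 0$ be real numbers, and let $f(s)=e^{\alpha s}(s-\beta)+e^{-\alpha s}(s+\beta)$ for $s\in\mathbb{C}$. Multiplicities of zeros are those of $f$ as a holomorphic function on $\mathbb{C}$. Then all non-real zeros of $f$ are simple and lie on the line $\operatorname{Re} s=0$. As for the real zeros of $f$: (i) If $\beta<0$, then $s=0$ is the only real zero of $f$, and it is simple. (ii) If $\beta>0$, then: (a) for $\alpha<1/\beta$, $s=0$ is the only real zero of $f$, and it is simple; (b) for $\alpha=1/\beta$, $s=0$ is the only real zero of $f$, and it is a triple zero; (c) for $\alpha>1/\beta$, there is a real number $\gamma>0$ such that $f$ has exactly the three real zeros $0$, $\gamma$ and $-\gamma$, and all three are simple. Moreover, all zeros in $\mathbb{C}\setminus\{1\}$ of the meromorphic function $$\zeta_2(s)=1+2^{-s}-\frac{2^{1-s}}{1-s}$$ are simple and lie on the line $\operatorname{Re} s=0$. -/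

import Mathlib

/-- The entire function `f(s) = e^{αs}(s - β) + e^{-αs}(s + β)` of a complex variable `s`. -/
noncomputable def alphaBetaFun (α β : ℝ) (s : ℂ) : ℂ :=
  Complex.exp (α * s) * (s - β) + Complex.exp (-α * s) * (s + β)

/-- The function `ζ₂(s) = 1 + 2^{-s} - 2^{1-s}/(1-s)`, meromorphic on `ℂ` and holomorphic away
from `s = 1` (the value at `s = 1` is meaningless and is never used). -/
noncomputable def zetaTwo (s : ℂ) : ℂ :=
  1 + (2 : ℂ) ^ (-s) - (2 : ℂ) ^ (1 - s) / (1 - s)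

/-! Write `f = 2(s cosh αs - β sinh αs)` and eliminate `β` in three ways. The imaginary part of `f =
0` times `conj (sinh αs)` gives `y sinh 2αx = x sin 2αy` for `s = x + iy`; since `|sin t| < |t| <
|sinh t|` off `0`, this forces `x = 0` or `y = 0`. Combining `f = 0` with `f' = 0` gives `sinh 2αs =
2αs`, which on either axis has only the solution `0`; so zeros other than `0` are simple. Positive
real zeros solve `x coth αx = β`, whose left side is strictly increasing and exceeds `1/α`. Finally
`ζ₂` is `f` with `α = log 2 / 2`, `β = 1`, up to a non-vanishing factor. -/

open Complex in
theorem alphaBetaFun_eq (α β : ℝ) (s : ℂ) :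
    alphaBetaFun α β s = 2 * (s * cosh (α * s) - β * sinh (α * s)) := by
  rw [alphaBetaFun, cosh, sinh, neg_mul]
  ring

theorem differentiable_alphaBetaFun (α β : ℝ) : Differentiable ℂ (alphaBetaFun α β) := by
  unfold alphaBetaFun
  fun_prop

theorem analyticAt_alphaBetaFun (α β : ℝ) (s : ℂ) : AnalyticAt ℂ (alphaBetaFun α β) s :=
  (differentiable_alphaBetaFun α β).analyticAt s

open Complex in
theorem deriv_alphaBetaFun (α β : ℝ) :
    deriv (alphaBetaFun α β) =
      fun s ↦ 2 * ((1 - α * β) * cosh (α * s) + α * s * sinh (α * s)) := by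
  funext s
  have hz : HasDerivAt (fun s : ℂ ↦ α * s) α s := by
    simpa using (hasDerivAt_id s).const_mul (α : ℂ)
  have h := (((hasDerivAt_id s).mul hz.ccosh).sub (hz.csinh.const_mul (β : ℂ))).const_mul (2 : ℂ)
  rw [funext (alphaBetaFun_eq α β)]
  refine (h.congr_deriv ?_).deriv
  simp only [id]
  ring

theorem alphaBetaFun_zero (α β : ℝ) : alphaBetaFun α β 0 = 0 := by
  simp [alphaBetaFun]

theorem alphaBetaFun_neg (α β : ℝ) (s : ℂ) : alphaBetaFun α β (-s) = -alphaBetaFun α β s := by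
  simp only [alphaBetaFun_eq, mul_neg, Complex.cosh_neg, Complex.sinh_neg]
  ring

theorem alphaBetaFun_ofReal_eq_zero_iff (α β x : ℝ) :
    alphaBetaFun α β x = 0 ↔ x * Real.cosh (α * x) = β * Real.sinh (α * x) := by
  rw [alphaBetaFun_eq, mul_eq_zero, or_iff_right two_ne_zero, sub_eq_zero]
  norm_cast

/-! ### Multiplicities -/

/-- A multiple zero `s` of `alphaBetaFun α β` makes `2 α s` a fixed point of `sinh`. -/
theorem sinh_fixed_of_multiple_zero {α β : ℝ} {s : ℂ} (h : alphaBetaFun α β s = 0)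
    (h' : deriv (alphaBetaFun α β) s = 0) :
    Complex.sinh (2 * (α * s)) = 2 * (α * s) := by
  rw [deriv_alphaBetaFun] at h'
  rw [alphaBetaFun_eq] at h
  have h1 := Complex.cosh_sq_sub_sinh_sq (α * s)
  rw [Complex.sinh_two_mul]
  -- The `β` terms cancel, and `cosh² - sinh² = 1` reduces the rest.
  linear_combination Complex.sinh (α * s) * h' - α * Complex.cosh (α * s) * h + 2 * (α * s) * h1

theorem eq_zero_of_sinh_fixed {α : ℝ} (hα : 0 < α) {s : ℂ} (hs : s.re = 0 ∨ s.im = 0)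
    (h : Complex.sinh (2 * (α * s)) = 2 * (α * s)) : s = 0 := by
  rcases hs with hs | hs
  · obtain ⟨y, rfl⟩ : ∃ y : ℝ, s = y * Complex.I := ⟨s.im, Complex.ext (by simp [hs]) (by simp)⟩
    rw [show 2 * ((α : ℂ) * (y * Complex.I)) = ((2 * (α * y) : ℝ) : ℂ) * Complex.I by
      push_cast; ring, Complex.sinh_mul_I] at h
    have h2 := mul_right_cancel₀ Complex.I_ne_zero h
    norm_cast at h2
    by_contra hne
    have hy : y ≠ 0 := by rintro rfl; simp at hne
    have := Real.abs_sin_lt_abs (x := 2 * (α * y)) (by positivity)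
    rw [h2] at this
    exact this.false
  · obtain ⟨x, rfl⟩ : ∃ x : ℝ, s = x := ⟨s.re, Complex.ext (by simp) (by simp [hs])⟩
    norm_cast at h
    have h1 : 2 * (α * x) = 0 := le_antisymm
      (not_lt.1 fun h0 ↦ (Real.self_lt_sinh_iff.2 h0).ne' h)
      (not_lt.1 fun h0 ↦ (Real.sinh_lt_self_iff.2 h0).ne h)
    have : x = 0 := by simpa [hα.ne'] using h1
    simp [this]

theorem analyticOrderAt_alphaBetaFun_eq_one {α β : ℝ} (hα : 0 < α) {s : ℂ} (hs0 : s ≠ 0)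
    (hs : s.re = 0 ∨ s.im = 0) (h : alphaBetaFun α β s = 0) :
    analyticOrderAt (alphaBetaFun α β) s = 1 :=
  (analyticAt_alphaBetaFun α β s).analyticOrderAt_eq_one_of_zero_deriv_ne_zero h
    fun h' ↦ hs0 (eq_zero_of_sinh_fixed hα hs (sinh_fixed_of_multiple_zero h h'))

theorem analyticOrderAt_alphaBetaFun_zero {α β : ℝ} (h : α * β ≠ 1) :
    analyticOrderAt (alphaBetaFun α β) 0 = 1 := by
  refine (analyticAt_alphaBetaFun α β 0).analyticOrderAt_eq_one_of_zero_deriv_ne_zero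
    (alphaBetaFun_zero α β) ?_
  rw [deriv_alphaBetaFun]
  have : (1 : ℂ) - α * β ≠ 0 := by
    rw [sub_ne_zero]
    exact_mod_cast h.symm
  simpa using this

/-- The derivative collapses to `2αs sinh αs`, a product of two factors with simple zeros at `0`. -/
theorem analyticOrderAt_alphaBetaFun_zero_of_mul_eq_one {α β : ℝ} (hα : 0 < α) (h : α * β = 1) :
    analyticOrderAt (alphaBetaFun α β) 0 = 3 := by
  have hα' : (α : ℂ) ≠ 0 := by exact_mod_cast hα.ne'
  have h1 : deriv (alphaBetaFun α β) =
      (fun s : ℂ ↦ 2 * α * s) * fun s : ℂ ↦ Complex.sinh (α * s) := by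
    rw [deriv_alphaBetaFun]
    funext s
    have : (α : ℂ) * β = 1 := by exact_mod_cast h
    simp only [this, Pi.mul_apply]
    ring
  have h2 : HasDerivAt (fun s : ℂ ↦ 2 * α * s) (2 * α) 0 := by
    simpa using (hasDerivAt_id (0 : ℂ)).const_mul (2 * α : ℂ)
  have h3 : HasDerivAt (fun s : ℂ ↦ α * s) α 0 := by
    simpa using (hasDerivAt_id (0 : ℂ)).const_mul (α : ℂ)
  have a2 : AnalyticAt ℂ (fun s : ℂ ↦ 2 * α * s) 0 := by fun_prop
  have a3 : AnalyticAt ℂ (fun s : ℂ ↦ Complex.sinh (α * s)) 0 :=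
    (show Differentiable ℂ fun s : ℂ ↦ Complex.sinh (α * s) by fun_prop).analyticAt 0
  have key := (analyticAt_alphaBetaFun α β 0).analyticOrderAt_deriv_add_one
  rw [h1, analyticOrderAt_mul a2 a3,
    a2.analyticOrderAt_eq_one_of_zero_deriv_ne_zero (by simp) (by rw [h2.deriv]; simpa using hα.ne'),
    a3.analyticOrderAt_eq_one_of_zero_deriv_ne_zero (by simp)
      (by rw [h3.csinh.deriv]; simpa using hα.ne')] at key
  simp only [alphaBetaFun_zero, sub_zero] at key
  rw [← key]
  norm_num

/-! ### Non-real zeros -/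

/-- At a zero, `s cosh(αs) conj(sinh(αs))` is real; its imaginary part is computed here. -/
theorem im_mul_sinh_eq_re_mul_sin {α β : ℝ} {s : ℂ} (h : alphaBetaFun α β s = 0) :
    s.im * Real.sinh (2 * (α * s.re)) = s.re * Real.sin (2 * (α * s.im)) := by
  rw [alphaBetaFun_eq, mul_eq_zero, or_iff_right two_ne_zero] at h
  obtain ⟨x, y⟩ := s
  have hz : (α : ℂ) * ⟨x, y⟩ = (α * x : ℝ) + (α * y : ℝ) * Complex.I :=
    Complex.ext (by simp) (by simp)
  rw [hz, Complex.cosh_add, Complex.sinh_add, Complex.cosh_mul_I, Complex.sinh_mul_I] at h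
  simp only [← Complex.ofReal_cosh, ← Complex.ofReal_sinh, ← Complex.ofReal_cos,
    ← Complex.ofReal_sin] at h
  rw [Real.sinh_two_mul, Real.sin_two_mul]
  have h1 := Real.cosh_sq_sub_sinh_sq (α * x)
  have h2 := Real.sin_sq_add_cos_sq (α * y)
  generalize Real.sinh (α * x) = S at *
  generalize Real.cosh (α * x) = C at *
  generalize Real.sin (α * y) = p at *
  generalize Real.cos (α * y) = q at *
  rw [Complex.ext_iff] at h
  obtain ⟨hre, him⟩ := h
  simp at hre him
  -- `S q` and `C p` are the real and imaginary parts of `sinh αs`, so these multipliers remove `β`.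
  linear_combination 2 * S * q * him - 2 * C * p * hre + 2 * x * p * q * h1 - 2 * y * S * C * h2

theorem re_eq_zero_of_alphaBetaFun_eq_zero {α β : ℝ} (hα : 0 < α) {s : ℂ} (hs : s.im ≠ 0)
    (h : alphaBetaFun α β s = 0) : s.re = 0 := by
  by_contra hx
  have key := congrArg abs (im_mul_sinh_eq_re_mul_sin h)
  rw [abs_mul, abs_mul, Real.abs_sinh] at key
  have h1 := Real.self_lt_sinh_iff.2 (abs_pos.2 (show 2 * (α * s.re) ≠ 0 by positivity))
  have h2 := Real.abs_sin_lt_abs (show 2 * (α * s.im) ≠ 0 by positivity)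
  have e1 : |2 * (α * s.re)| = 2 * α * |s.re| := by
    rw [← mul_assoc, abs_mul, abs_of_pos (by positivity)]
  have e2 : |2 * (α * s.im)| = 2 * α * |s.im| := by
    rw [← mul_assoc, abs_mul, abs_of_pos (by positivity)]
  rw [e2] at h2
  nth_rw 1 [e1] at h1
  have h3 := mul_lt_mul_of_pos_left h1 (abs_pos.2 hs)
  have h4 := mul_lt_mul_of_pos_left h2 (abs_pos.2 hx)
  nlinarith

/-! ### Real zeros -/

theorem sinh_lt_mul_cosh {t : ℝ} (ht : 0 < t) : Real.sinh t < t * Real.cosh t := by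
  have hmono : StrictMonoOn (fun t : ℝ ↦ t * Real.cosh t - Real.sinh t) (Set.Ici 0) := by
    refine strictMonoOn_of_deriv_pos (convex_Ici 0) (by fun_prop) fun x hx ↦ ?_
    rw [interior_Ici, Set.mem_Ioi] at hx
    have h := ((hasDerivAt_id x).mul (Real.hasDerivAt_cosh x)).sub (Real.hasDerivAt_sinh x)
    have e : deriv (fun t : ℝ ↦ t * Real.cosh t - Real.sinh t) x = x * Real.sinh x :=
      (h.congr_deriv (by simp)).deriv
    rw [e]
    exact mul_pos hx (Real.sinh_pos_iff.2 hx)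
  have := hmono Set.self_mem_Ici ht.le ht
  simp at this
  linarith

/-- The numerator of the derivative is a positive multiple of `sinh 2αx - 2αx`. -/
theorem strictMonoOn_mul_cosh_div_sinh {α : ℝ} (hα : 0 < α) :
    StrictMonoOn (fun x : ℝ ↦ x * Real.cosh (α * x) / Real.sinh (α * x)) (Set.Ioi 0) := by
  have hpos : ∀ x ∈ Set.Ioi (0 : ℝ), 0 < Real.sinh (α * x) := fun x hx ↦
    Real.sinh_pos_iff.2 (mul_pos hα hx)
  refine strictMonoOn_of_deriv_pos (convex_Ioi 0) ?_ fun x hx ↦ ?_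
  · exact ContinuousOn.div (by fun_prop) (by fun_prop) fun x hx ↦ (hpos x hx).ne'
  · rw [interior_Ioi] at hx
    have hx' := hpos x hx
    have hz : HasDerivAt (fun x : ℝ ↦ α * x) α x := by
      simpa using (hasDerivAt_id x).const_mul α
    have h := ((hasDerivAt_id x).mul hz.cosh).div hz.sinh hx'.ne'
    have e : deriv (fun x : ℝ ↦ x * Real.cosh (α * x) / Real.sinh (α * x)) x =
        (Real.sinh (2 * (α * x)) - 2 * (α * x)) / (2 * Real.sinh (α * x) ^ 2) := by
      refine (h.congr_deriv ?_).deriv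
      rw [Real.sinh_two_mul]
      have h1 := Real.cosh_sq (α * x)
      simp
      field_simp
      linear_combination (-α * x) * h1
    rw [e]
    have := Real.self_lt_sinh_iff.2 (show 0 < 2 * (α * x) from by
      have : 0 < x := hx
      positivity)
    exact div_pos (by linarith) (by positivity)

theorem realZeros_eq_singleton {α β : ℝ}
    (h : ∀ x : ℝ, 0 < x → x * Real.cosh (α * x) ≠ β * Real.sinh (α * x)) :
    {x : ℝ | alphaBetaFun α β (x : ℂ) = 0} = {0} := by
  ext x
  simp only [Set.mem_ofPred_eq, Set.mem_singleton_iff]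
  refine ⟨fun hx ↦ ?_, fun hx ↦ by simp [hx, alphaBetaFun_zero]⟩
  rcases lt_trichotomy x 0 with h0 | h0 | h0
  · refine absurd ((alphaBetaFun_ofReal_eq_zero_iff α β (-x)).1 ?_) (h (-x) (by linarith))
    rw [Complex.ofReal_neg, alphaBetaFun_neg, hx, neg_zero]
  · exact h0
  · exact absurd ((alphaBetaFun_ofReal_eq_zero_iff α β x).1 hx) (h x h0)

theorem realZeros_of_neg {α β : ℝ} (hα : 0 < α) (hβ : β < 0) :
    {x : ℝ | alphaBetaFun α β (x : ℂ) = 0} = {0} := by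
  refine realZeros_eq_singleton fun x hx he ↦ ?_
  have h1 := mul_pos hx (Real.cosh_pos (α * x))
  have h2 := mul_neg_of_neg_of_pos hβ (Real.sinh_pos_iff.2 (mul_pos hα hx))
  linarith

theorem realZeros_of_mul_le_one {α β : ℝ} (hα : 0 < α) (h : α * β ≤ 1) :
    {x : ℝ | alphaBetaFun α β (x : ℂ) = 0} = {0} := by
  refine realZeros_eq_singleton fun x hx he ↦ ?_
  have h1 := sinh_lt_mul_cosh (mul_pos hα hx)
  have h2 := Real.sinh_pos_iff.2 (mul_pos hα hx)
  have h3 : α * x * Real.cosh (α * x) = α * β * Real.sinh (α * x) := by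
    rw [mul_assoc, he, mul_assoc]
  nlinarith

theorem exists_pos_realZero {α β : ℝ} (hα : 0 < α) (hβ : 0 < β) (h : 1 < α * β) :
    ∃ γ : ℝ, 0 < γ ∧ γ * Real.cosh (α * γ) = β * Real.sinh (α * γ) := by
  -- At `x = t/α` the difference of the two sides is `β(t - sinh t) < 0`; at `x = β` it is `β
  -- e^(-αβ) > 0`. With `uIcc` these endpoints need not be ordered.
  set t := Real.arcosh (α * β)
  have ht : 0 < t := Real.arcosh_pos h
  have hc : Real.cosh t = α * β := Real.cosh_arcosh h.le
  have hcont : ContinuousOn (fun x : ℝ ↦ x * Real.cosh (α * x) - β * Real.sinh (α * x))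
      (Set.uIcc (t / α) β) := by fun_prop
  have h0 : (0 : ℝ) ∈ Set.uIcc (t / α * Real.cosh (α * (t / α)) - β * Real.sinh (α * (t / α)))
      (β * Real.cosh (α * β) - β * Real.sinh (α * β)) := by
    refine Set.Icc_subset_uIcc ⟨?_, ?_⟩
    · rw [mul_div_cancel₀ _ hα.ne', hc, show t / α * (α * β) = β * t by field_simp]
      nlinarith [Real.self_lt_sinh_iff.2 ht]
    · nlinarith [Real.sinh_lt_cosh (α * β)]
  obtain ⟨γ, hγ, e⟩ := intermediate_value_uIcc hcont h0
  exact ⟨γ, (lt_min (div_pos ht hα) hβ).trans_le hγ.1, sub_eq_zero.1 e⟩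

theorem realZeros_of_pos_realZero {α β γ : ℝ} (hα : 0 < α) (hγ : 0 < γ)
    (h : γ * Real.cosh (α * γ) = β * Real.sinh (α * γ)) :
    {x : ℝ | alphaBetaFun α β (x : ℂ) = 0} = {0, γ, -γ} := by
  have huniq : ∀ x : ℝ, 0 < x → alphaBetaFun α β (x : ℂ) = 0 → x = γ := by
    intro x hx hz
    refine (strictMonoOn_mul_cosh_div_sinh hα).injOn hx hγ ?_
    have hx' := (Real.sinh_pos_iff.2 (mul_pos hα hx)).ne'
    have hγ' := (Real.sinh_pos_iff.2 (mul_pos hα hγ)).ne'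
    simp only [(alphaBetaFun_ofReal_eq_zero_iff α β x).1 hz, h, mul_div_cancel_right₀ _ hx',
      mul_div_cancel_right₀ _ hγ']
  have hzero : alphaBetaFun α β (γ : ℂ) = 0 := (alphaBetaFun_ofReal_eq_zero_iff α β γ).2 h
  ext x
  simp only [Set.mem_ofPred_eq, Set.mem_insert_iff, Set.mem_singleton_iff]
  constructor
  · intro hx
    rcases lt_trichotomy x 0 with h0 | h0 | h0
    · right; right
      rw [← huniq (-x) (by linarith) (by rw [Complex.ofReal_neg, alphaBetaFun_neg, hx, neg_zero]),
        neg_neg]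
    · exact .inl h0
    · exact .inr (.inl (huniq x h0 hx))
  · rintro (rfl | rfl | rfl)
    · simp [alphaBetaFun_zero]
    · exact hzero
    · rw [Complex.ofReal_neg, alphaBetaFun_neg, hzero, neg_zero]

/-! ### The function `ζ₂` -/

theorem zetaTwo_eq_mul {s : ℂ} (hs : s ≠ 1) :
    zetaTwo s = Complex.exp (-(Real.log 2 / 2 : ℝ) * s) / (s - 1) *
      alphaBetaFun (Real.log 2 / 2) 1 s := by
  have h1 : 1 - s ≠ 0 := sub_ne_zero.2 hs.symm
  have h2 : s - 1 ≠ 0 := sub_ne_zero.2 hs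
  set E := Complex.exp (-(Real.log 2 / 2 : ℝ) * s) with hE
  -- `E` is the square root of `2^(-s)`; factoring it out symmetrises the exponentials.
  have e1 : (2 : ℂ) ^ (-s) = E * E := by
    rw [Complex.cpow_def_of_ne_zero two_ne_zero, ← Complex.exp_add, ← Complex.ofReal_ofNat,
      ← Complex.ofReal_log zero_le_two]
    congr 1
    push_cast
    ring
  have e2 : (2 : ℂ) ^ (1 - s) = 2 * (E * E) := by
    rw [sub_eq_add_neg, Complex.cpow_add _ _ two_ne_zero, e1, Complex.cpow_one]
  have e3 : E * Complex.exp ((Real.log 2 / 2 : ℝ) * s) = 1 := by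
    rw [hE, ← Complex.exp_add]
    simp
  rw [zetaTwo, alphaBetaFun, e1, e2, ← hE, Complex.ofReal_one]
  rw [show E / (s - 1) * (Complex.exp ((Real.log 2 / 2 : ℝ) * s) * (s - 1) + E * (s + 1)) =
    (E * Complex.exp ((Real.log 2 / 2 : ℝ) * s)) * ((s - 1) / (s - 1)) +
      E * E * (s + 1) / (s - 1) by ring, e3, div_self h2]
  field_simp
  ring

theorem analyticOrderAt_zetaTwo {s : ℂ} (hs : s ≠ 1) :
    analyticOrderAt zetaTwo s = analyticOrderAt (alphaBetaFun (Real.log 2 / 2) 1) s := by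
  have heq : zetaTwo =ᶠ[nhds s] (fun s : ℂ ↦ Complex.exp (-(Real.log 2 / 2 : ℝ) * s) / (s - 1)) *
      alphaBetaFun (Real.log 2 / 2) 1 := by
    filter_upwards [isOpen_ne.mem_nhds hs] with z hz using zetaTwo_eq_mul hz
  have ha : AnalyticAt ℂ (fun s : ℂ ↦ Complex.exp (-(Real.log 2 / 2 : ℝ) * s) / (s - 1)) s := by
    refine AnalyticAt.div ?_ (by fun_prop) (sub_ne_zero.2 hs)
    exact (show Differentiable ℂ fun s : ℂ ↦ Complex.exp (-(Real.log 2 / 2 : ℝ) * s) by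
      fun_prop).analyticAt s
  rw [analyticOrderAt_congr heq, analyticOrderAt_mul ha (analyticAt_alphaBetaFun _ _ s),
    ha.analyticOrderAt_eq_zero.2 (div_ne_zero (Complex.exp_ne_zero _) (sub_ne_zero.2 hs)), zero_add]

theorem proposition6p1 :
    (∀ α β : ℝ, 0 < α → β ≠ 0 →
      -- the non-real zeros are simple and lie on the imaginary axis
      (∀ s : ℂ, s.im ≠ 0 → alphaBetaFun α β s = 0 →
        s.re = 0 ∧ analyticOrderAt (alphaBetaFun α β) s = 1) ∧
      -- the real zeros, with their multiplicities
      (β < 0 →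
        {x : ℝ | alphaBetaFun α β (x : ℂ) = 0} = {0} ∧
        analyticOrderAt (alphaBetaFun α β) 0 = 1) ∧
      (0 < β → α < 1 / β →
        {x : ℝ | alphaBetaFun α β (x : ℂ) = 0} = {0} ∧
        analyticOrderAt (alphaBetaFun α β) 0 = 1) ∧
      (0 < β → α = 1 / β →
        {x : ℝ | alphaBetaFun α β (x : ℂ) = 0} = {0} ∧
        analyticOrderAt (alphaBetaFun α β) 0 = 3) ∧
      (0 < β → 1 / β < α →
        ∃ γ : ℝ, 0 < γ ∧
          {x : ℝ | alphaBetaFun α β (x : ℂ) = 0} = {0, γ, -γ} ∧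
          analyticOrderAt (alphaBetaFun α β) 0 = 1 ∧
          analyticOrderAt (alphaBetaFun α β) (γ : ℂ) = 1 ∧
          analyticOrderAt (alphaBetaFun α β) (-γ : ℂ) = 1)) ∧
    -- the zeros of the meromorphic function `ζ₂` are simple and lie on the imaginary axis
    (∀ s : ℂ, s ≠ 1 → zetaTwo s = 0 →
      s.re = 0 ∧ analyticOrderAt zetaTwo s = 1) := by
  refine ⟨fun α β hα hβ ↦ ⟨fun s hs h ↦ ?_, fun hneg ↦ ?_, fun hpos hlt ↦ ?_, fun hpos he ↦ ?_,
    fun hpos hgt ↦ ?_⟩, fun s hs h ↦ ?_⟩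
  · have hre := re_eq_zero_of_alphaBetaFun_eq_zero hα hs h
    exact ⟨hre, analyticOrderAt_alphaBetaFun_eq_one hα (by rintro rfl; simp at hs) (.inl hre) h⟩
  · exact ⟨realZeros_of_neg hα hneg,
      analyticOrderAt_alphaBetaFun_zero (by nlinarith [mul_neg_of_pos_of_neg hα hneg])⟩
  · rw [lt_div_iff₀ hpos] at hlt
    exact ⟨realZeros_of_mul_le_one hα hlt.le, analyticOrderAt_alphaBetaFun_zero hlt.ne⟩
  · rw [eq_div_iff hpos.ne'] at he
    exact ⟨realZeros_of_mul_le_one hα he.le, analyticOrderAt_alphaBetaFun_zero_of_mul_eq_one hα he⟩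
  · rw [div_lt_iff₀ hpos] at hgt
    obtain ⟨γ, hγ, hz⟩ := exists_pos_realZero hα hpos hgt
    have hzero : alphaBetaFun α β (γ : ℂ) = 0 := (alphaBetaFun_ofReal_eq_zero_iff α β γ).2 hz
    have hγ0 : (γ : ℂ) ≠ 0 := by exact_mod_cast hγ.ne'
    exact ⟨γ, hγ, realZeros_of_pos_realZero hα hγ hz, analyticOrderAt_alphaBetaFun_zero hgt.ne',
      analyticOrderAt_alphaBetaFun_eq_one hα hγ0 (.inr (by simp)) hzero,
      analyticOrderAt_alphaBetaFun_eq_one hα (neg_ne_zero.2 hγ0) (.inr (by simp))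
        (by rw [alphaBetaFun_neg, hzero, neg_zero])⟩
  · have hα : 0 < Real.log 2 / 2 := by positivity
    -- This is the case `αβ < 1`: the only real zero is `0`, which already lies on the imaginary
    -- axis.
    have hlt : Real.log 2 / 2 * 1 < 1 := by linarith [Real.log_two_lt_d9]
    have hz : alphaBetaFun (Real.log 2 / 2) 1 s = 0 := by
      rw [zetaTwo_eq_mul hs] at h
      exact (mul_eq_zero.1 h).resolve_left
        (div_ne_zero (Complex.exp_ne_zero _) (sub_ne_zero.2 hs))
    rw [analyticOrderAt_zetaTwo hs]
    by_cases him : s.im = 0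
    · have hmem : s.re ∈ {x : ℝ | alphaBetaFun (Real.log 2 / 2) 1 (x : ℂ) = 0} := by
        rwa [Set.mem_ofPred_eq, show (s.re : ℂ) = s from Complex.ext (by simp) (by simp [him])]
      rw [realZeros_of_mul_le_one hα hlt.le, Set.mem_singleton_iff] at hmem
      obtain rfl : s = 0 := Complex.ext hmem him
      exact ⟨rfl, analyticOrderAt_alphaBetaFun_zero hlt.ne⟩
    · have hre := re_eq_zero_of_alphaBetaFun_eq_zero hα him hz
      exact ⟨hre, analyticOrderAt_alphaBetaFun_eq_one hα (by rintro rfl; simp at him) (.inl hre) hz⟩
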